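/- Let $\mathbb{D}=\mathbb{Z}[1/6]$, let $F_d$ be the free group on $y_1,\dots,y_d$, with $F_d\subset F_{d+1}$, and for $Q\subseteq F_d$ put $\mathbf A(Q)=\mathbb{D}F_d/\langle (x-1)^3 : x\in Q\rangle$ (quotient by the two-sided ideal). Let $\omega(\mathbf A(Q))$ be the image in $\mathbf A(Q)$ of the augmentation ideal of $\mathbb{D}F_d$, and let $U_i$ be the image of $y_i-1$. A monomial is a formal product $\nu=U_{i_1}^{\varepsilon_1}\cdots U_{i_s}^{\varepsilon_s}$ with $s\ge 1$, $i_t\neq i_{t+1}$ and $\varepsilon_t\in\{1,2\}$; its word is $r_\nu=y_{i_1}^{\delta_1}\cdots y_{i_s}^{\delta_s}\in F_d$, where $\delta_t=1$ if $\varepsilon_t=1$ and $\delta_t=-1$ if $\varepsilon_t=2$. Let $$P=\{y_1,\;y_2,\;y_1y_2,\;y_1^{-1}y_2,\;y_1^2y_2,\;y_1y_2^2,\;[y_1,y_2]\},\qquad [y_1,y_2]=y_1^{-1}y_2^{-1}y_1y_2 .$$ Theorem. There are finite sets $P_d\subseteq F_d$ $(d\ge 1)$ with $P_1=\{y_1\}$,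 $P_2=P$ and $P\subseteq P_d$ for all $d\ge 2$, such that for every $d\ge 1$ the ring $\mathbf A_d=\mathbf A(P_d)=\mathbb{D}F_d/\langle (x-1)^3 : x\in P_d\rangle$ has finite $\mathbb{D}$-rank (it is a finitely generated $\mathbb{D}$-module) and its augmentation ideal $\omega(\mathbf A_d)$ is nilpotent. Moreover the $P_d$ can be built inductively from $P$ as follows: for each $d\ge 2$ there is a finite set $W_d$ of monomials, nonzero in $\mathbf A_d$, whose values generate $\omega(\mathbf A_d)$ as a $\mathbb{D}$-module, such that, with $\widetilde P_d$ the closure of $P_d\cup\{r_\nu:\nu\in W_d\}$ under taking nonempty initial segments of reduced words, $$P_{d+1}=\widetilde P_d\,\cup\,\{y_{d+1}\}\,\cup\,\{hy_{d+1},\;h^{-1}y_{d+1},\;hy_{d+1}^2,\;h^2y_{d+1} : h\in\widetilde P_d\}.$$ -/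

import Mathlib

namespace CubicUnipotent

noncomputable section

/-- The coefficient ring `ℤ[1/6]`. -/
def Coeff : Type := Localization.Away (6 : ℤ)

instance : CommRing Coeff := inferInstanceAs (CommRing (Localization.Away (6 : ℤ)))

/-- The free group of rank `d`, with free generators indexed by `0, …, d - 1`. -/
abbrev F (d : ℕ) : Type := FreeGroup (Fin d)

/-- The group ring of `F d` over `ℤ[1/6]`. -/
abbrev GroupRing (d : ℕ) : Type := MonoidAlgebra Coeff (F d)

/-- The two-sided ideal generated by the elements `(x - 1) ^ 3` for `x ∈ P`. -/
def cubicIdeal {d : ℕ} (P : Set (F d)) : TwoSidedIdeal (GroupRing d) :=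
  TwoSidedIdeal.span {z | ∃ x ∈ P, z = (MonoidAlgebra.of Coeff (F d) x - 1) ^ 3}

/-- The quotient of the group ring by the two-sided ideal generated by the `(x - 1) ^ 3`, `x ∈ P`. -/
abbrev A {d : ℕ} (P : Set (F d)) : Type := (cubicIdeal P).ringCon.Quotient

/-- The quotient homomorphism. -/
def proj {d : ℕ} (P : Set (F d)) : GroupRing d →ₐ[Coeff] A P :=
  RingCon.mkₐ Coeff (cubicIdeal P).ringCon

/-- The augmentation homomorphism of the group ring, sending every group element to `1`. -/
def augmentation (d : ℕ) : GroupRing d →ₐ[Coeff] Coeff :=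
  MonoidAlgebra.lift Coeff Coeff (F d) 1

/-- The augmentation ideal of the quotient ring: the image of the augmentation ideal of the
group ring, as a `ℤ[1/6]`-submodule. -/
def augmentationIdeal {d : ℕ} (P : Set (F d)) : Submodule Coeff (A P) :=
  (LinearMap.ker (augmentation d).toLinearMap).map (proj P).toLinearMap

/-- The element `u(a_i) = a_i - 1`, where `a_i` is the image of the `i`-th free generator. -/
def U {d : ℕ} (P : Set (F d)) (i : Fin d) : A P :=
  proj P (MonoidAlgebra.of Coeff (F d) (FreeGroup.of i) - 1)

/-- The value in the quotient ring of a formal monomial `U_{i₁}^{ε₁} ⋯ U_{iₛ}^{εₛ}` with exponents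
`1` or `2`. A letter `(i, true)` stands for `U_i` and a letter `(i, false)` for `U_i ^ 2`. -/
def monomialValue {d : ℕ} (P : Set (F d)) (ν : List (Fin d × Bool)) : A P :=
  (ν.map fun l => U P l.1 ^ (if l.2 then 1 else 2)).prod

/-- The word `r_ν` of the formal monomial `ν`: it has the letter `y_i` for `U_i` and the letter
`y_i⁻¹` for `U_i ^ 2`. -/
def wordOf {d : ℕ} (ν : List (Fin d × Bool)) : F d :=
  (ν.map fun l => if l.2 then FreeGroup.of l.1 else (FreeGroup.of l.1)⁻¹).prod

/-- `W` is a finite set of nonempty formal monomials, neighbouring letters having different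
indices, whose values are nonzero and generate the augmentation ideal as a `ℤ[1/6]`-module. -/
structure IsGeneratingMonomials {d : ℕ} (P : Set (F d)) (W : Set (List (Fin d × Bool))) :
    Prop where
  finite : W.Finite
  ne_nil : ∀ ν ∈ W, ν ≠ []
  isChain : ∀ ν ∈ W, ν.IsChain fun k l => k.1 ≠ l.1
  ne_zero : ∀ ν ∈ W, monomialValue P ν ≠ 0
  span_eq : Submodule.span Coeff (monomialValue P '' W) = augmentationIdeal P

/-- The closure of `S` under taking (nonempty) initial segments of reduced words. -/
def segmentClosure {d : ℕ} (S : Set (F d)) : Set (F d) :=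
  S ∪ {g | ∃ h ∈ S, ∃ L : List (Fin d × Bool), L ≠ [] ∧ L <+: h.toWord ∧ g = FreeGroup.mk L}

/-- For `Q ⊆ F d` and the new generator `y` of `F (d + 1)`, the set of all elements
`h`, `y`, `h y`, `h⁻¹ y`, `h y²`, `h² y` with `h ∈ Q`. -/
def nextSet {d : ℕ} (Q : Set (F d)) : Set (F (d + 1)) :=
  let Q' : Set (F (d + 1)) := FreeGroup.map Fin.castSucc '' Q
  let y : F (d + 1) := FreeGroup.of (Fin.last d)
  Q' ∪ {y} ∪ (fun h => h * y) '' Q' ∪ (fun h => h⁻¹ * y) '' Q' ∪ (fun h => h * y ^ 2) '' Q'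
    ∪ (fun h => h ^ 2 * y) '' Q'

/-- The set
`{y₁, y₂, y₁y₂, y₁⁻¹y₂, y₁²y₂, y₁y₂², [y₁, y₂]}` with `[y₁, y₂] = y₁⁻¹y₂⁻¹y₁y₂`. -/
def P₂ : Set (F 2) :=
  let y₁ : F 2 := FreeGroup.of 0
  let y₂ : F 2 := FreeGroup.of 1
  {y₁, y₂, y₁ * y₂, y₁⁻¹ * y₂, y₁ ^ 2 * y₂, y₁ * y₂ ^ 2, y₁⁻¹ * y₂⁻¹ * y₁ * y₂}

end

end CubicUnipotent

/-! The proof adjoins one free generator y at a time. Put b = y - 1 and call g a cubic unipotent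
when (g - 1)³ = 0. If x, y, xy, x⁻¹y and xy² are cubic unipotents and 2, 3 are invertible, linear
combinations of the cubic relations give b² x⁻¹ b² = 0 and express b x⁻¹ b through terms containing
b². They also make x⁻¹y² a cubic unipotent, so the same holds with x and x⁻¹ exchanged
(`cubic_pair`).

Let R be the image of the old augmentation ideal, T the span of b and S = 1 + R. If R is linearly
spanned by elements x⁻¹ - 1 and x - 1 with x as above, then T²ST² = 0 and TST lies in ST²S. Hence
(ST)⁴ = 0, and nilpotency of R passes to R + T (`sup_span_pow_eq_bot`). The new augmentation ideal
is generated as a right ideal by elements of R + T, so it is nilpotent too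
(`isNilpotent_augmentationIdeal_succ`).

The induction needs finitely many group elements h whose h - 1 span the augmentation ideal.
Nilpotency leaves only finitely many nonzero monomials, and the word of a monomial is that monomial
plus terms of lower degree. By this triangularity the words suffice
(`augmentationIdeal_eq_span_of_wordOf_mem`). -/

namespace CubicUnipotent

/-! ### Identities for cubic unipotents -/

section Ring

variable {B : Type*} [Ring B]

/-- For units `x`, `y` the relation `(x * y - 1) ^ 3 = 0` in a balanced form. -/
theorem cubic_mul_iff (x y : Bˣ) :
    ((x * y : B) - 1) ^ 3 = 0 ↔
      (x * y * x - 3 * x + 3 * ↑y⁻¹ - ↑y⁻¹ * ↑x⁻¹ * ↑y⁻¹ : B) = 0 := by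
  -- The outer factors x y and y are units. In the remaining bracket the powers of b = y - 1 stay
  -- low, so the relations for y, y⁻¹, y² can be combined linearly.
  have key : ((x * y : B) - 1) ^ 3 =
      x * y * (x * y * x - 3 * x + 3 * ↑y⁻¹ - ↑y⁻¹ * ↑x⁻¹ * ↑y⁻¹ : B) * y := by
    have h : (x * y * (x * y * x - 3 * x + 3 * ↑y⁻¹ - ↑y⁻¹ * ↑x⁻¹ * ↑y⁻¹ : B) * y) =
        x * y * x * y * x * y - 3 * (x * y * x * y) + 3 * (x * (y * ↑y⁻¹) * y)
          - x * (y * ↑y⁻¹) * ↑x⁻¹ * (↑y⁻¹ * y) := by noncomm_ring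
    rw [h]
    simp only [Units.mul_inv, Units.inv_mul, mul_one]
    noncomm_ring
  rw [key, Units.mul_left_eq_zero, mul_assoc, Units.mul_right_eq_zero, Units.mul_right_eq_zero]

theorem cubic_inv {g : Bˣ} (h : ((g : B) - 1) ^ 3 = 0) : ((↑g⁻¹ : B) - 1) ^ 3 = 0 := by
  have e : (↑g⁻¹ : B) - 1 = -(↑g⁻¹ * (g - 1)) := by
    rw [mul_sub, Units.inv_mul]; noncomm_ring
  have hc : Commute (↑g⁻¹ : B) ((g : B) - 1) :=
    ((Commute.refl (g : B)).units_inv_left).sub_right (Commute.one_right _)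
  rw [e, neg_pow, hc.mul_pow, h, mul_zero, mul_zero]

theorem cubic_mul_comm {x y : Bˣ} (h : ((x * y : B) - 1) ^ 3 = 0) :
    ((y * x : B) - 1) ^ 3 = 0 := by
  have e : ((y * x : B) - 1) = ↑x⁻¹ * ((x * y : B) - 1) * x := by
    rw [mul_sub, sub_mul, mul_one, Units.inv_mul, ← mul_assoc, Units.inv_mul, one_mul]
  have e' : ((y * x : B) - 1) ^ 3 = ↑x⁻¹ * ((x * y : B) - 1) ^ 3 * x := by
    rw [e]
    have h1 : ∀ w : B, (↑x⁻¹ * w * x) ^ 3 = ↑x⁻¹ * (w * (x * ↑x⁻¹) * w * (x * ↑x⁻¹) * w) * x := by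
      intro w; noncomm_ring
    rw [h1, Units.mul_inv]; noncomm_ring
  rw [e', h, mul_zero, zero_mul]

theorem cubic_inv_mul {x y : Bˣ} (h : ((x * y : B) - 1) ^ 3 = 0) :
    ((↑x⁻¹ * ↑y⁻¹ : B) - 1) ^ 3 = 0 := by
  have := cubic_inv (g := y * x) (by simpa using cubic_mul_comm h)
  simpa using this

theorem inv_eq_of_cubic {g : Bˣ} (h : ((g : B) - 1) ^ 3 = 0) :
    (↑g⁻¹ : B) = 1 - (g - 1) + (g - 1) ^ 2 := by
  have : (↑g⁻¹ : B) * ((g : B) * (1 - (g - 1) + (g - 1) ^ 2) - 1) = 0 := by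
    have e : (g : B) * (1 - (g - 1) + (g - 1) ^ 2) - 1 = ((g : B) - 1) ^ 3 := by noncomm_ring
    rw [e, h, mul_zero]
  rw [mul_sub, mul_one, ← mul_assoc, Units.inv_mul, one_mul, sub_eq_zero] at this
  exact this.symm

/-- The identities that link `b` with `x` and `x'` when `(x - 1) ^ 3 = 0`, `x' = x⁻¹`, and `x y`,
`x y⁻¹`, `x y ^ 2` are cubic unipotents for `y = 1 + b`, in their balanced form. -/
theorem balanced_identities (h3 : ∀ z : B, 3 * z = 0 → z = 0)
    {x x' b : B} (hb : b ^ 3 = 0)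
    (e0 : x * x - 3 * x + 3 - x' = 0)
    (e1 : x * (1 + b) * x - 3 * x + 3 * (1 - b + b ^ 2)
      - (1 - b + b ^ 2) * x' * (1 - b + b ^ 2) = 0)
    (em : x * (1 - b + b ^ 2) * x - 3 * x + 3 * (1 + b) - (1 + b) * x' * (1 + b) = 0)
    (e2 : x * (1 + 2 * b + b ^ 2) * x - 3 * x + 3 * (1 - 2 * b + 3 * b ^ 2)
      - (1 - 2 * b + 3 * b ^ 2) * x' * (1 - 2 * b + 3 * b ^ 2) = 0) :
    b ^ 2 * x' * b ^ 2 = 0 ∧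
    2 * (b * x' * b) = x * b ^ 2 * x + 3 * b ^ 2 - b ^ 2 * x' - x' * b ^ 2 ∧
    x * (1 - 2 * b + 3 * b ^ 2) * x - 3 * x + 3 * (1 + 2 * b + b ^ 2)
      - (1 + 2 * b + b ^ 2) * x' * (1 + 2 * b + b ^ 2) = 0 := by
  have hw : b * x' * b ^ 2 + b ^ 2 * x' * b = 2 * (b ^ 2 * x' * b ^ 2) := by
    refine sub_eq_zero.mp (h3 _ ?_)
    -- The coefficients -3, -1, 1, 3 cancel every term except those with x' surrounded by at least
    -- three factors b.
    have : (3 * (b * x' * b ^ 2 + b ^ 2 * x' * b - 2 * (b ^ 2 * x' * b ^ 2)) : B) =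
      (-3) * (x * (1 + b) * x - 3 * x + 3 * (1 - b + b ^ 2)
        - (1 - b + b ^ 2) * x' * (1 - b + b ^ 2))
      - (x * (1 - b + b ^ 2) * x - 3 * x + 3 * (1 + b) - (1 + b) * x' * (1 + b))
      + (x * (1 + 2 * b + b ^ 2) * x - 3 * x + 3 * (1 - 2 * b + 3 * b ^ 2)
        - (1 - 2 * b + 3 * b ^ 2) * x' * (1 - 2 * b + 3 * b ^ 2))
      + 3 * (x * x - 3 * x + 3 - x') := by noncomm_ring
    rw [this, e0, e1, em, e2]; simp
  have hz : b ^ 2 * x' * b ^ 2 = 0 := by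
    -- Multiplying by b on the left leaves only b² x' b², since b³ = 0.
    have h : b * (b * x' * b ^ 2 + b ^ 2 * x' * b) = b * (2 * (b ^ 2 * x' * b ^ 2)) := by rw [hw]
    have l : b * (b * x' * b ^ 2 + b ^ 2 * x' * b) = b ^ 2 * x' * b ^ 2 + b ^ 3 * x' * b := by
      noncomm_ring
    have r : b * (2 * (b ^ 2 * x' * b ^ 2)) = 2 * (b ^ 3 * x' * b ^ 2) := by noncomm_ring
    rw [l, r, hb] at h
    simpa using h
  rw [hz, mul_zero] at hw
  have e0' : x * x - 3 * x + 3 * 1 - x' = 0 := by rwa [mul_one]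
  refine ⟨hz, ?_, ?_⟩
  -- Adding the relations for y and y⁻¹ cancels the terms linear in b.
  · have : 2 * (b * x' * b) - (x * b ^ 2 * x + 3 * b ^ 2 - b ^ 2 * x' - x' * b ^ 2) =
      -(x * (1 + b) * x - 3 * x + 3 * (1 - b + b ^ 2)
        - (1 - b + b ^ 2) * x' * (1 - b + b ^ 2))
      - (x * (1 - b + b ^ 2) * x - 3 * x + 3 * (1 + b) - (1 + b) * x' * (1 + b))
      + 2 * (x * x - 3 * x + 3 * 1 - x')
      + (b * x' * b ^ 2 + b ^ 2 * x' * b) - b ^ 2 * x' * b ^ 2 := by noncomm_ring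
    rw [← sub_eq_zero, this, e0', e1, em, hw, hz]; simp
  · have : x * (1 - 2 * b + 3 * b ^ 2) * x - 3 * x + 3 * (1 + 2 * b + b ^ 2)
      - (1 + 2 * b + b ^ 2) * x' * (1 + 2 * b + b ^ 2) =
      (x * (1 + 2 * b + b ^ 2) * x - 3 * x + 3 * (1 - 2 * b + 3 * b ^ 2)
        - (1 - 2 * b + 3 * b ^ 2) * x' * (1 - 2 * b + 3 * b ^ 2))
      - 2 * (x * (1 + b) * x - 3 * x + 3 * (1 - b + b ^ 2)
        - (1 - b + b ^ 2) * x' * (1 - b + b ^ 2))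
      + 2 * (x * (1 - b + b ^ 2) * x - 3 * x + 3 * (1 + b) - (1 + b) * x' * (1 + b))
      - 6 * (b * x' * b ^ 2 + b ^ 2 * x' * b) + 6 * (b ^ 2 * x' * b ^ 2) := by noncomm_ring
    rw [this, e1, em, e2, hw, hz]; simp

theorem cubic_mul_one_iff (x : Bˣ) :
    ((x : B) - 1) ^ 3 = 0 ↔ (x * x - 3 * x + 3 - ↑x⁻¹ : B) = 0 := by
  simpa using cubic_mul_iff x 1

/-- If `x`, `y`, `x y`, `x⁻¹ y` and `x y ^ 2` are cubic unipotents, and `b = y - 1`, then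
`b ^ 2 * x⁻¹ * b ^ 2 = 0`, the product `b * x⁻¹ * b` is a combination of terms containing `b ^ 2`,
and `x⁻¹ y ^ 2` is a cubic unipotent, too. -/
theorem cubic_pair (h3 : ∀ z : B, 3 * z = 0 → z = 0)
    {x y : Bˣ} {b : B} (hb : b = y - 1) (hx : ((x : B) - 1) ^ 3 = 0) (hy : ((y : B) - 1) ^ 3 = 0)
    (h1 : ((x * y : B) - 1) ^ 3 = 0) (hm : ((↑x⁻¹ * y : B) - 1) ^ 3 = 0)
    (hsq : ((x * y ^ 2 : B) - 1) ^ 3 = 0) :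
    b ^ 2 * ↑x⁻¹ * b ^ 2 = 0 ∧
    2 * (b * ↑x⁻¹ * b) = x * b ^ 2 * x + 3 * b ^ 2 - b ^ 2 * ↑x⁻¹ - ↑x⁻¹ * b ^ 2 ∧
    ((↑x⁻¹ * y ^ 2 : B) - 1) ^ 3 = 0 := by
  have hb3 : b ^ 3 = 0 := by rw [hb]; exact hy
  have vy : (y : B) = 1 + b := by rw [hb]; noncomm_ring
  have vyi : (↑y⁻¹ : B) = 1 - b + b ^ 2 := by rw [inv_eq_of_cubic hy, hb]
  have vy2 : ((y ^ 2 : Bˣ) : B) = 1 + 2 * b + b ^ 2 := by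
    rw [Units.val_pow_eq_pow_val, vy]; noncomm_ring
  have vyi2 : (↑(y ^ 2)⁻¹ : B) = 1 - 2 * b + 3 * b ^ 2 := by
    rw [← inv_pow, Units.val_pow_eq_pow_val, vyi]
    have : (1 - b + b ^ 2) ^ 2 = 1 - 2 * b + 3 * b ^ 2 - 2 * b ^ 3 + b * b ^ 3 := by noncomm_ring
    rw [this, hb3]; simp
  have hm' : ((x * ↑y⁻¹ : B) - 1) ^ 3 = 0 := by simpa using cubic_inv_mul hm
  have e0 := (cubic_mul_one_iff x).mp hx
  have e1 := (cubic_mul_iff x y).mp h1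
  have em := (cubic_mul_iff x y⁻¹).mp hm'
  have e2 := (cubic_mul_iff x (y ^ 2)).mp (by simpa using hsq)
  rw [vy, vyi] at e1
  rw [inv_inv, vy, vyi] at em
  rw [vy2, vyi2] at e2
  obtain ⟨r1, r2, r3⟩ := balanced_identities h3 hb3 e0 e1 em e2
  refine ⟨r1, r2, ?_⟩
  have h : ((x * ↑(y ^ 2)⁻¹ : B) - 1) ^ 3 = 0 := by
    rw [cubic_mul_iff, inv_inv, vy2, vyi2]; exact r3
  simpa using cubic_inv_mul h

end Ring

/-! ### Nilpotency of a sum of submodules -/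

section Submodules

variable {C B : Type*} [CommRing C] [Ring B] [Algebra C B]

/-- If `R` is a nilpotent subalgebra and `T` is such that `(R¹ T) ^ 4 = 0`, then `R + T` generates
a nilpotent subalgebra. -/
theorem sup_pow_eq_bot {R T : Submodule C B} (hR : R * R ≤ R) {N : ℕ} (hN : R ^ N = ⊥)
    (hT : ((1 ⊔ R) * T) ^ 4 = ⊥) : (R ⊔ T) ^ (N * 4) = ⊥ := by
  -- A descending chain of right ideals: R preserves each one and T moves it down a step. Since R ^
  -- N = 0, any N factors from R + T also move down a step, and the fourth ideal is zero.
  set I : ℕ → Submodule C B := fun k => ((1 ⊔ R) * T) ^ k * ⊤ with hI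
  have hTI : ∀ k, T * I k ≤ I (k + 1) := fun k => by
    have : T ≤ (1 ⊔ R) * T := by
      calc T = 1 * T := (one_mul T).symm
        _ ≤ _ := mul_le_mul' le_sup_left le_rfl
    simp only [hI, pow_succ', mul_assoc]
    rw [← mul_assoc (1 ⊔ R)]
    exact mul_le_mul' this le_rfl
  have hRR : R * (1 ⊔ R) ≤ 1 ⊔ R := by
    rw [Submodule.mul_sup, mul_one]
    exact sup_le le_sup_right (hR.trans le_sup_right)
  have hRI : ∀ k, R * I k ≤ I k := fun k => by
    rcases k with _ | k
    · simp [hI]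
    · simp only [hI, pow_succ', ← mul_assoc]
      gcongr
  have hmono : ∀ k, I (k + 1) ≤ I k := fun k => by
    simp only [hI, pow_succ, mul_assoc]
    gcongr
    exact le_top
  have hRn : ∀ n k, R ^ n * I k ≤ I k := fun n k => by
    induction n with
    | zero => simp
    | succ n ih =>
      rw [pow_succ', mul_assoc]
      exact (mul_le_mul' le_rfl ih).trans (hRI k)
  have step : ∀ k n, (R ⊔ T) ^ n * I k ≤ R ^ n * I k ⊔ I (k + 1) := fun k n => by
    induction n with
    | zero => simp
    | succ n ih =>
      rw [pow_succ', mul_assoc]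
      refine (mul_le_mul' le_rfl ih).trans ?_
      rw [Submodule.mul_sup, Submodule.sup_mul, Submodule.sup_mul, ← mul_assoc R, ← pow_succ']
      refine sup_le (sup_le le_sup_left ?_) (sup_le ?_ ?_)
      · exact ((mul_le_mul' le_rfl (hRn n k)).trans (hTI k)).trans le_sup_right
      · exact (hRI _).trans le_sup_right
      · exact ((hTI _).trans (hmono _)).trans le_sup_right
  have stepN : ∀ k, (R ⊔ T) ^ N * I k ≤ I (k + 1) := fun k => by
    simpa [hN] using step k N
  have all : ∀ k, (R ⊔ T) ^ (N * k) * I 0 ≤ I k := fun k => by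
    induction k with
    | zero => simp
    | succ k ih =>
      rw [Nat.mul_succ, Nat.add_comm, pow_add, mul_assoc]
      exact (mul_le_mul' le_rfl ih).trans (stepN k)
  have h4 := all 4
  simp only [hI, hT, Submodule.bot_mul, pow_zero, one_mul, le_bot_iff] at h4
  rw [eq_bot_iff, ← h4]
  calc (R ⊔ T) ^ (N * 4) = (R ⊔ T) ^ (N * 4) * 1 := (mul_one _).symm
    _ ≤ _ := mul_le_mul' le_rfl le_top

/-- With S = 1 + R, the fourth power of ST contains two blocks TST. Each can be replaced by ST²S;
the two factors T² then enclose only S, and T²ST² = 0. -/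
theorem one_sup_mul_pow_four_eq_bot {R T : Submodule C B} (hR : R * R ≤ R)
    (h3 : T ^ 3 = ⊥) (h5 : T ^ 2 * R * T ^ 2 = ⊥)
    (hM : T * R * T ≤ (1 ⊔ R) * T ^ 2 * (1 ⊔ R)) : ((1 ⊔ R) * T) ^ 4 = ⊥ := by
  set S := 1 ⊔ R with hS
  have h1S : 1 ≤ S := le_sup_left
  have hSS : S * S ≤ S := by
    rw [hS, Submodule.mul_sup, Submodule.sup_mul, Submodule.sup_mul, mul_one, one_mul]
    exact sup_le (sup_le le_sup_left (by rw [mul_one]; exact le_sup_right))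
      (sup_le le_sup_right (hR.trans le_sup_right))
  have hTST : T * S * T ≤ S * T ^ 2 * S := by
    rw [hS, Submodule.mul_sup, Submodule.sup_mul, mul_one, ← hS]
    refine sup_le ?_ hM
    calc T * T = 1 * T ^ 2 * 1 := by rw [one_mul, mul_one, sq]
      _ ≤ _ := by gcongr
  have hzero : T ^ 2 * S * T ^ 2 = ⊥ := by
    rw [hS, Submodule.mul_sup, Submodule.sup_mul, mul_one, h5, sup_bot_eq, ← pow_add,
      show 2 + 2 = 3 + 1 from rfl, pow_add, h3, Submodule.bot_mul]
  rw [eq_bot_iff]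
  calc (S * T) ^ 4 = S * (T * S * T) * S * (T * S * T) := by
        simp only [pow_succ, pow_zero, one_mul, mul_assoc]
    _ ≤ S * (S * T ^ 2 * S) * S * (S * T ^ 2 * S) := by gcongr
    _ = S * S * T ^ 2 * (S * S * S) * T ^ 2 * S := by simp only [mul_assoc]
    _ ≤ S * S * T ^ 2 * S * T ^ 2 * S := by
        gcongr
        exact (mul_le_mul' hSS le_rfl).trans hSS
    _ = S * S * (T ^ 2 * S * T ^ 2) * S := by simp only [mul_assoc]
    _ = ⊥ := by rw [hzero]; simp

/-- A nilpotent subalgebra `R` spanned by elements `x - 1` and `x⁻¹ - 1`, together with `y - 1`,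
generates a nilpotent subalgebra when `x`, `y`, `x y`, `x⁻¹ y` and `x y ^ 2` are cubic
unipotents. -/
theorem sup_span_pow_eq_bot (h2 : IsUnit (2 : C)) (h3 : IsUnit (3 : C)) {R : Submodule C B}
    (hR : R * R ≤ R) {N : ℕ} (hN : R ^ N = ⊥) {H : Set Bˣ} {y : Bˣ}
    (hspan : R = Submodule.span C
      ((fun x : Bˣ => (x : B) - 1) '' H ∪ (fun x : Bˣ => (↑x⁻¹ : B) - 1) '' H))
    (hy : ((y : B) - 1) ^ 3 = 0) (hx : ∀ x ∈ H, ((x : B) - 1) ^ 3 = 0)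
    (h1 : ∀ x ∈ H, ((x * y : B) - 1) ^ 3 = 0) (hm : ∀ x ∈ H, ((↑x⁻¹ * y : B) - 1) ^ 3 = 0)
    (hsq : ∀ x ∈ H, ((x * y ^ 2 : B) - 1) ^ 3 = 0) :
    (R ⊔ Submodule.span C {(y : B) - 1}) ^ (N * 4) = ⊥ := by
  have c3 : ∀ z : B, 3 * z = 0 → z = 0 := fun z hz => by
    have : (3 : C) • z = 0 := by rwa [Algebra.smul_def, map_ofNat]
    exact (h3.smul_eq_zero).mp this
  set b : B := (y : B) - 1 with hb
  set T := Submodule.span C {b} with hTdef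
  set S := 1 ⊔ R with hS
  set M := S * T ^ 2 * S with hMdef
  have hbT : b ∈ T := Submodule.mem_span_singleton_self b
  have hb2 : b ^ 2 ∈ T ^ 2 := Submodule.pow_mem_pow T hbT 2
  have hTn : ∀ n, T ^ n = Submodule.span C {b ^ n} := fun n => by
    rw [hTdef, Submodule.span_pow, Set.singleton_pow]
  have h1S : (1 : B) ∈ S := Submodule.mem_sup_left (Submodule.one_le.mp le_rfl)
  have hMmem : ∀ {u v : B}, u ∈ S → v ∈ S → u * b ^ 2 * v ∈ M := fun hu hv =>
    Submodule.mul_mem_mul (Submodule.mul_mem_mul hu hb2) hv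
  have hhalf : ∀ z : B, 2 * z ∈ M → z ∈ M := fun z hz => by
    obtain ⟨u, hu⟩ := h2
    have : z = (↑u⁻¹ : C) • (2 * z) := by
      have e : (2 * z : B) = (2 : C) • z := by rw [Algebra.smul_def, map_ofNat]
      rw [e, smul_smul, ← hu, Units.inv_mul, one_smul]
    rw [this]
    exact Submodule.smul_mem _ _ hz
  have memS : ∀ x ∈ H, (x : B) ∈ S ∧ (↑x⁻¹ : B) ∈ S := fun x hxH => by
    have m1 : (x : B) - 1 ∈ S := Submodule.mem_sup_right <| by
      rw [hspan]; exact Submodule.subset_span (Or.inl ⟨x, hxH, rfl⟩)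
    have m2 : (↑x⁻¹ : B) - 1 ∈ S := Submodule.mem_sup_right <| by
      rw [hspan]; exact Submodule.subset_span (Or.inr ⟨x, hxH, rfl⟩)
    exact ⟨by simpa using S.add_mem m1 h1S, by simpa using S.add_mem m2 h1S⟩
  -- Subtracting 1 from x⁻¹ is harmless: it contributes b⁴ = 0 in one product and b² ∈ M in the
  -- other.
  have core : ∀ x : Bˣ, (x : B) ∈ S → (↑x⁻¹ : B) ∈ S →
      b ^ 2 * ↑x⁻¹ * b ^ 2 = 0 →
      2 * (b * ↑x⁻¹ * b) = x * b ^ 2 * x + 3 * b ^ 2 - b ^ 2 * ↑x⁻¹ - ↑x⁻¹ * b ^ 2 →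
      b ^ 2 * (↑x⁻¹ - 1) * b ^ 2 = 0 ∧ b * (↑x⁻¹ - 1) * b ∈ M := by
    intro x m1 m2 r1 r2
    have hbM : b ^ 2 ∈ M := by simpa using hMmem h1S h1S
    constructor
    · have : b ^ 2 * (↑x⁻¹ - 1) * b ^ 2 = b ^ 2 * ↑x⁻¹ * b ^ 2 - b * b ^ 3 := by noncomm_ring
      rw [this, r1, hy]; simp
    · have : b * (↑x⁻¹ - 1) * b = b * ↑x⁻¹ * b - b ^ 2 := by noncomm_ring
      rw [this]
      refine M.sub_mem (hhalf _ ?_) hbM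
      rw [r2]
      refine M.sub_mem (M.sub_mem (M.add_mem (hMmem m1 m1) ?_) ?_) ?_
      · have : (3 * b ^ 2 : B) = (3 : C) • b ^ 2 := by rw [Algebra.smul_def, map_ofNat]
        rw [this]; exact M.smul_mem _ hbM
      · simpa using hMmem h1S m2
      · simpa using hMmem m2 h1S
  have gens : ∀ c ∈ ((fun x : Bˣ => (x : B) - 1) '' H ∪ (fun x : Bˣ => (↑x⁻¹ : B) - 1) '' H),
      b ^ 2 * c * b ^ 2 = 0 ∧ b * c * b ∈ M := by
    rintro c (⟨x, hxH, rfl⟩ | ⟨x, hxH, rfl⟩)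
    -- The generator x - 1 needs the identities for x⁻¹ in place of x, hence x⁻¹ y² cubic; that is
    -- the third conclusion for x.
    · obtain ⟨-, -, r⟩ := cubic_pair c3 hb (hx x hxH) hy (h1 x hxH) (hm x hxH) (hsq x hxH)
      obtain ⟨r1, r2, -⟩ := cubic_pair (x := x⁻¹) c3 hb (cubic_inv (hx x hxH)) hy (hm x hxH)
        (by simpa using h1 x hxH) r
      simpa using core x⁻¹ (memS x hxH).2 (by simpa using (memS x hxH).1) r1 r2
    · obtain ⟨r1, r2, -⟩ := cubic_pair c3 hb (hx x hxH) hy (h1 x hxH) (hm x hxH) (hsq x hxH)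
      exact core x (memS x hxH).1 (memS x hxH).2 r1 r2
  refine sup_pow_eq_bot hR hN (one_sup_mul_pow_four_eq_bot hR ?_ ?_ ?_)
  · rw [hTn, hy]; simp
  · rw [hTn, hspan, Submodule.span_mul_span, Submodule.span_mul_span, Submodule.span_eq_bot]
    rintro _ ⟨_, ⟨_, rfl, c, hc, rfl⟩, _, rfl, rfl⟩
    exact (gens c hc).1
  · rw [hspan, hTdef, Submodule.span_mul_span, Submodule.span_mul_span, Submodule.span_le]
    rintro _ ⟨_, ⟨_, rfl, c, hc, rfl⟩, _, rfl, rfl⟩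
    have := (gens c hc).2
    rwa [hMdef, hS, hspan, hTdef] at this

end Submodules

noncomputable section

/-! ### The quotient ring and its augmentation ideal -/

theorem isUnit_six : IsUnit (6 : Coeff) := by
  have := IsLocalization.Away.algebraMap_isUnit (S := Localization.Away (6 : ℤ)) (6 : ℤ)
  rwa [map_ofNat] at this

theorem isUnit_two : IsUnit (2 : Coeff) := by
  have h : (2 * 3 : Coeff) = 6 := by norm_num
  exact isUnit_of_mul_isUnit_left (h ▸ isUnit_six)

theorem isUnit_three : IsUnit (3 : Coeff) := by
  have h : (2 * 3 : Coeff) = 6 := by norm_num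
  exact isUnit_of_mul_isUnit_right (h ▸ isUnit_six)

variable {d : ℕ}

/-- The image in `A P` of an element of the free group. -/
def groupElem (P : Set (F d)) : F d →* A P :=
  ((proj P : GroupRing d →ₐ[Coeff] A P) : GroupRing d →* A P).comp (MonoidAlgebra.of Coeff (F d))

theorem groupElem_apply (P : Set (F d)) (g : F d) :
    groupElem P g = proj P (MonoidAlgebra.of Coeff (F d) g) := rfl

theorem U_eq (P : Set (F d)) (i : Fin d) : U P i = groupElem P (FreeGroup.of i) - 1 := by
  rw [U, map_sub, map_one, groupElem_apply]

theorem proj_surjective (P : Set (F d)) : Function.Surjective (proj P) :=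
  RingCon.mkₐ_surjective _

theorem proj_eq_zero_iff (P : Set (F d)) (z : GroupRing d) : proj P z = 0 ↔ z ∈ cubicIdeal P := by
  rw [TwoSidedIdeal.mem_iff, ← RingCon.eq]
  rfl

theorem groupElem_cubic {P : Set (F d)} {x : F d} (hx : x ∈ P) : (groupElem P x - 1) ^ 3 = 0 := by
  rw [groupElem_apply, ← map_one (proj P), ← map_sub, ← map_pow, proj_eq_zero_iff]
  exact TwoSidedIdeal.subset_span ⟨x, hx, rfl⟩

theorem groupRing_induction {p : GroupRing d → Prop} (z : GroupRing d)
    (single : ∀ (g : F d) (r : Coeff), p (r • MonoidAlgebra.of Coeff (F d) g))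
    (add : ∀ x y, p x → p y → p (x + y)) : p z := by
  induction z using MonoidAlgebra.induction_linear with
  | zero => simpa using single 1 0
  | add x y hx hy => exact add x y hx hy
  | single g r => simpa using single g r

theorem span_range_groupElem (P : Set (F d)) :
    Submodule.span Coeff (Set.range (groupElem P)) = ⊤ := by
  rw [eq_top_iff]
  rintro z -
  obtain ⟨z, rfl⟩ := proj_surjective P z
  induction z using groupRing_induction with
  | single g r =>
    rw [map_smul]
    exact Submodule.smul_mem _ _ (Submodule.subset_span ⟨g, rfl⟩)
  | add x y hx hy => rw [map_add]; exact Submodule.add_mem _ hx hy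

theorem groupElem_sub_one_mem (P : Set (F d)) (g : F d) :
    groupElem P g - 1 ∈ augmentationIdeal P := by
  refine ⟨MonoidAlgebra.of Coeff (F d) g - 1, ?_, ?_⟩
  · have : augmentation d (MonoidAlgebra.of Coeff (F d) g) = 1 := by
      rw [augmentation, MonoidAlgebra.lift_of]; rfl
    simp [LinearMap.mem_ker, map_sub, this, -MonoidAlgebra.of_apply]
  · simp only [AlgHom.toLinearMap_apply, map_sub, map_one, groupElem_apply]

theorem augmentationIdeal_eq_span (P : Set (F d)) :
    augmentationIdeal P = Submodule.span Coeff (Set.range fun g => groupElem P g - 1) := by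
  apply le_antisymm
  · rintro _ ⟨z, hz, rfl⟩
    -- Subtracting the augmentation turns each term r g into r (g - 1); on the kernel nothing is
    -- subtracted.
    have key : ∀ z : GroupRing d, proj P z - algebraMap Coeff (A P) (augmentation d z) ∈
        Submodule.span Coeff (Set.range fun g => groupElem P g - 1) := by
      intro z
      induction z using groupRing_induction with
      | single g r =>
        have : augmentation d (MonoidAlgebra.of Coeff (F d) g) = 1 := by
          rw [augmentation, MonoidAlgebra.lift_of]; rfl
        rw [map_smul, map_smul, this, Algebra.algebraMap_eq_smul_one, smul_assoc, one_smul,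
          ← smul_sub]
        exact Submodule.smul_mem _ _ (Submodule.subset_span ⟨g, rfl⟩)
      | add x y hx hy =>
        rw [map_add, map_add, map_add, add_sub_add_comm]
        exact Submodule.add_mem _ hx hy
    have hz' : augmentation d z = 0 := hz
    simpa [hz'] using key z
  · rw [Submodule.span_le]
    rintro _ ⟨g, rfl⟩
    exact groupElem_sub_one_mem P g

theorem U_mem (P : Set (F d)) (i : Fin d) : U P i ∈ augmentationIdeal P := by
  rw [U_eq]
  exact groupElem_sub_one_mem P _

theorem top_mul_augmentationIdeal_le (P : Set (F d)) :
    ⊤ * augmentationIdeal P ≤ augmentationIdeal P := by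
  nth_rw 1 [augmentationIdeal_eq_span P]
  rw [← span_range_groupElem, Submodule.span_mul_span, Submodule.span_le]
  rintro _ ⟨_, ⟨g, rfl⟩, _, ⟨h, rfl⟩, rfl⟩
  have : groupElem P g * (groupElem P h - 1) =
      (groupElem P (g * h) - 1) - (groupElem P g - 1) := by
    rw [map_mul]; noncomm_ring
  change groupElem P g * (groupElem P h - 1) ∈ _
  rw [this]
  exact Submodule.sub_mem _ (groupElem_sub_one_mem P _) (groupElem_sub_one_mem P _)

theorem augmentationIdeal_mul_self_le (P : Set (F d)) :
    augmentationIdeal P * augmentationIdeal P ≤ augmentationIdeal P :=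
  (mul_le_mul' le_top le_rfl).trans (top_mul_augmentationIdeal_le P)

/-- The augmentation ideal is generated, as a right ideal, by the elements `U P i`. -/
theorem augmentationIdeal_le_span_U_mul_top (P : Set (F d)) :
    augmentationIdeal P ≤ Submodule.span Coeff (Set.range (U P)) * ⊤ := by
  have hU : ∀ (i : Fin d) (z : A P), U P i * z ∈ Submodule.span Coeff (Set.range (U P)) * ⊤ :=
    fun i z => Submodule.mul_mem_mul (Submodule.subset_span ⟨i, rfl⟩) trivial
  -- The arbitrary right factor z lets the induction use (xy - 1)z = (x - 1)(yz) + (y - 1)z.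
  have key : ∀ (g : F d) (z : A P),
      (groupElem P g - 1) * z ∈ Submodule.span Coeff (Set.range (U P)) * ⊤ := by
    intro g
    induction g using FreeGroup.induction_on with
    | C1 => intro z; simp
    | of i => intro z; simpa [U_eq] using hU i z
    | inv_of i _ =>
      intro z
      have : (groupElem P (FreeGroup.of i)⁻¹ - 1) * z =
          -(U P i * (groupElem P (FreeGroup.of i)⁻¹ * z)) := by
        rw [U_eq, ← mul_assoc, sub_mul _ _ (groupElem P _), ← map_mul, mul_inv_cancel, map_one]
        noncomm_ring
      rw [this]
      exact Submodule.neg_mem _ (hU _ _)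
    | mul x y hx hy =>
      intro z
      have : (groupElem P (x * y) - 1) * z =
          (groupElem P x - 1) * (groupElem P y * z) + (groupElem P y - 1) * z := by
        rw [map_mul]; noncomm_ring
      rw [this]
      exact Submodule.add_mem _ (hx _) (hy _)
  rw [augmentationIdeal_eq_span, Submodule.span_le]
  rintro _ ⟨g, rfl⟩
  simpa using key g 1

/-- The universal property of `A P`: a homomorphism from the free group to an algebra that maps
`P` to cubic unipotents extends to `A P`. -/
def liftA {B : Type*} [Ring B] [Algebra Coeff B] {P : Set (F d)} (f : F d →* B)
    (hf : ∀ x ∈ P, (f x - 1) ^ 3 = 0) : A P →ₐ[Coeff] B :=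
  (cubicIdeal P).ringCon.liftₐ (MonoidAlgebra.lift Coeff B (F d) f) <| by
    have h : cubicIdeal P ≤ TwoSidedIdeal.ker (MonoidAlgebra.lift Coeff B (F d) f) := by
      rw [cubicIdeal, TwoSidedIdeal.span_le]
      rintro _ ⟨x, hx, rfl⟩
      rw [SetLike.mem_coe, TwoSidedIdeal.mem_ker, map_pow, map_sub, map_one, MonoidAlgebra.lift_of]
      exact hf x hx
    intro x y hxy
    have := h ((TwoSidedIdeal.rel_iff _ x y).mp hxy)
    rw [TwoSidedIdeal.mem_ker, map_sub, sub_eq_zero] at this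
    exact this

theorem liftA_groupElem {B : Type*} [Ring B] [Algebra Coeff B] {P : Set (F d)} (f : F d →* B)
    (hf : ∀ x ∈ P, (f x - 1) ^ 3 = 0) (g : F d) : liftA f hf (groupElem P g) = f g := by
  change MonoidAlgebra.lift Coeff B (F d) f (MonoidAlgebra.of _ _ g) = _
  rw [MonoidAlgebra.lift_of]

/-- A homomorphism of free groups that maps `P` into `P'` induces a homomorphism
`A P → A P'`. -/
def mapA {d' : ℕ} {P : Set (F d)} {P' : Set (F d')} (f : F d →* F d') (hf : f '' P ⊆ P') :
    A P →ₐ[Coeff] A P' :=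
  liftA ((groupElem P').comp f) fun x hx => groupElem_cubic (hf ⟨x, hx, rfl⟩)

theorem mapA_groupElem {d' : ℕ} {P : Set (F d)} {P' : Set (F d')} (f : F d →* F d')
    (hf : f '' P ⊆ P') (g : F d) : mapA f hf (groupElem P g) = groupElem P' (f g) :=
  liftA_groupElem _ _ g

/-! ### Adjoining a generator -/

/-- Adjoining a free generator preserves nilpotency of the augmentation ideal, provided that
sufficiently many products with the new generator are cubic unipotents. -/
theorem isNilpotent_augmentationIdeal_succ {P : Set (F d)} {P' : Set (F (d + 1))} {H : Set (F d)}
    (hP : FreeGroup.map Fin.castSucc '' P ⊆ P') (hnil : IsNilpotent (augmentationIdeal P))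
    (hspan : augmentationIdeal P = Submodule.span Coeff
      ((fun h => groupElem P h - 1) '' H ∪ (fun h => groupElem P h⁻¹ - 1) '' H))
    (hy : FreeGroup.of (Fin.last d) ∈ P')
    (hH : ∀ h ∈ H, FreeGroup.map Fin.castSucc h ∈ P' ∧
      FreeGroup.map Fin.castSucc h * FreeGroup.of (Fin.last d) ∈ P' ∧
      (FreeGroup.map Fin.castSucc h)⁻¹ * FreeGroup.of (Fin.last d) ∈ P' ∧
      FreeGroup.map Fin.castSucc h * FreeGroup.of (Fin.last d) ^ 2 ∈ P') :
    IsNilpotent (augmentationIdeal P') := by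
  obtain ⟨N, hN⟩ := hnil
  set f : F d →* F (d + 1) := FreeGroup.map Fin.castSucc with hf
  set φ := mapA f hP with hφ
  set R := (augmentationIdeal P).map φ.toLinearMap with hR
  set u := (groupElem P').toHomUnits with hu
  have hval : ∀ g, (u g : A P') = groupElem P' g := fun g => rfl
  have hRspan : R = Submodule.span Coeff
      ((fun x : (A P')ˣ => (x : A P') - 1) '' ((fun h => u (f h)) '' H) ∪
        (fun x : (A P')ˣ => (↑x⁻¹ : A P') - 1) '' ((fun h => u (f h)) '' H)) := by
    rw [hR, hspan, Submodule.map_span, Set.image_union, Set.image_image, Set.image_image,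
      Set.image_image, Set.image_image]
    congr 3
    · funext h
      simp [hφ, mapA_groupElem, hval]
    · funext h
      simp only [AlgHom.toLinearMap_apply, map_sub, map_one, hφ, mapA_groupElem, ← hval, map_inv]
  have hRR : R * R ≤ R := by
    rw [hR, ← Submodule.map_mul]
    exact Submodule.map_mono (augmentationIdeal_mul_self_le P)
  have hRN : R ^ N = ⊥ := by
    rw [hR, ← Submodule.map_pow, hN]
    exact Submodule.map_bot _
  have hG := sup_span_pow_eq_bot isUnit_two isUnit_three hRR hRN (y := u (FreeGroup.of (Fin.last d)))
    hRspan (by rw [hval]; exact groupElem_cubic hy)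
    (by
      rintro _ ⟨h, hh, rfl⟩
      rw [hval]; exact groupElem_cubic (hH h hh).1)
    (by
      rintro _ ⟨h, hh, rfl⟩
      rw [hval, hval, ← map_mul]; exact groupElem_cubic (hH h hh).2.1)
    (by
      rintro _ ⟨h, hh, rfl⟩
      rw [← map_inv, hval, hval, ← map_mul]; exact groupElem_cubic (hH h hh).2.2.1)
    (by
      rintro _ ⟨h, hh, rfl⟩
      rw [hval, hval, ← map_pow, ← map_mul]; exact groupElem_cubic (hH h hh).2.2.2)
  rw [hval, ← U_eq] at hG
  set G := R ⊔ Submodule.span Coeff {U P' (Fin.last d)} with hGdef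
  set J := augmentationIdeal P' with hJ
  have hUG : Submodule.span Coeff (Set.range (U P')) ≤ G := by
    rw [Submodule.span_le]
    rintro _ ⟨i, rfl⟩
    induction i using Fin.lastCases with
    | last => exact Submodule.mem_sup_right (Submodule.mem_span_singleton_self _)
    | cast i =>
      refine Submodule.mem_sup_left ⟨U P i, U_mem P i, ?_⟩
      simp [U_eq, hφ, mapA_groupElem, hf]
  have hGJ : G ≤ J := by
    refine sup_le ?_ ?_
    · rw [hRspan, Submodule.span_le]
      rintro _ (⟨_, ⟨h, -, rfl⟩, rfl⟩ | ⟨_, ⟨h, -, rfl⟩, rfl⟩)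
      · exact groupElem_sub_one_mem P' _
      · change (↑(u (f h))⁻¹ : A P') - 1 ∈ _
        rw [← map_inv]
        exact groupElem_sub_one_mem P' _
    · rw [Submodule.span_le, Set.singleton_subset_iff]
      exact U_mem P' _
  have hJG : J ≤ G * ⊤ :=
    (augmentationIdeal_le_span_U_mul_top P').trans (mul_le_mul' hUG le_rfl)
  -- G need not be an ideal, but J is a left ideal: it absorbs the factor ⊤ before being replaced by
  -- G * ⊤.
  have hpow : ∀ n, J ^ n ≤ G ^ n * ⊤ := fun n => by
    induction n with
    | zero => rw [pow_zero, pow_zero, one_mul]; exact le_top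
    | succ n ih =>
      rw [pow_succ, pow_succ]
      calc J ^ n * J ≤ G ^ n * ⊤ * J := mul_le_mul' ih le_rfl
        _ = G ^ n * (⊤ * J) := mul_assoc _ _ _
        _ ≤ G ^ n * J := mul_le_mul' le_rfl (top_mul_augmentationIdeal_le P')
        _ ≤ G ^ n * (G * ⊤) := mul_le_mul' le_rfl hJG
        _ = G ^ n * G * ⊤ := (mul_assoc _ _ _).symm
  refine ⟨N * 4, ?_⟩
  have := hpow (N * 4)
  rwa [hG, Submodule.bot_mul, le_bot_iff] at this

/-! ### Monomials, degrees and their words -/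

/-- The product in `A P` of the elements `U P i` along a list of indices. -/
def letterProd (P : Set (F d)) (l : List (Fin d)) : A P := (l.map (U P)).prod

theorem letterProd_cons (P : Set (F d)) (i : Fin d) (l : List (Fin d)) :
    letterProd P (i :: l) = U P i * letterProd P l := by
  simp [letterProd]

theorem letterProd_append (P : Set (F d)) (l m : List (Fin d)) :
    letterProd P (l ++ m) = letterProd P l * letterProd P m := by
  simp [letterProd]

/-- The span of the products of fewer than `k` elements `U P i`. -/
def lowDegree (P : Set (F d)) (k : ℕ) : Submodule Coeff (A P) :=
  Submodule.span Coeff (letterProd P '' {l | l.length < k})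

theorem letterProd_mem_lowDegree (P : Set (F d)) {l : List (Fin d)} {k : ℕ} (h : l.length < k) :
    letterProd P l ∈ lowDegree P k :=
  Submodule.subset_span ⟨l, h, rfl⟩

theorem lowDegree_mono (P : Set (F d)) : Monotone (lowDegree P) := fun _ _ h =>
  Submodule.span_mono (Set.image_mono fun _ hl => lt_of_lt_of_le hl h)

/-- The bounds are strict: lengths at most j - 1 and k - 1 add up to at most j + k - 2. -/
theorem mul_mem_lowDegree {P : Set (F d)} {j k : ℕ} {x y : A P} (hx : x ∈ lowDegree P j)
    (hy : y ∈ lowDegree P k) : x * y ∈ lowDegree P (j + k - 1) := by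
  have h : lowDegree P j * lowDegree P k ≤ lowDegree P (j + k - 1) := by
    rw [lowDegree, lowDegree, Submodule.span_mul_span, Submodule.span_le]
    rintro _ ⟨_, ⟨l, hl, rfl⟩, _, ⟨m, hm, rfl⟩, rfl⟩
    change letterProd P l * letterProd P m ∈ _
    rw [← letterProd_append]
    refine letterProd_mem_lowDegree P ?_
    simp only [Set.mem_ofPred_eq] at hl hm
    rw [List.length_append]
    omega
  exact h (Submodule.mul_mem_mul hx hy)

theorem one_mem_lowDegree (P : Set (F d)) {k : ℕ} (hk : 0 < k) : 1 ∈ lowDegree P k := by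
  simpa [letterProd] using letterProd_mem_lowDegree P (l := []) hk

theorem U_mem_lowDegree (P : Set (F d)) (i : Fin d) {k : ℕ} (hk : 1 < k) :
    U P i ∈ lowDegree P k := by
  simpa [letterProd] using letterProd_mem_lowDegree P (l := [i]) hk

theorem U_sq_mem_lowDegree (P : Set (F d)) (i : Fin d) {k : ℕ} (hk : 2 < k) :
    U P i ^ 2 ∈ lowDegree P k := by
  simpa [letterProd, sq] using letterProd_mem_lowDegree P (l := [i, i]) hk

theorem groupElem_of (P : Set (F d)) (i : Fin d) :
    groupElem P (FreeGroup.of i) = 1 + U P i := by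
  rw [U_eq]; noncomm_ring

variable {P : Set (F d)}

theorem U_pow_three {i : Fin d} (hi : FreeGroup.of i ∈ P) : U P i ^ 3 = 0 := by
  rw [U_eq]; exact groupElem_cubic hi

theorem groupElem_of_inv {i : Fin d} (hi : FreeGroup.of i ∈ P) :
    groupElem P (FreeGroup.of i)⁻¹ = 1 - U P i + U P i ^ 2 := by
  rw [U_eq]
  have h := groupElem_cubic hi
  have := inv_eq_of_cubic (g := (groupElem P).toHomUnits (FreeGroup.of i)) h
  rw [← map_inv] at this
  exact this

theorem exists_groupElem_mem_lowDegree (hP : ∀ i, FreeGroup.of i ∈ P) (g : F d) :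
    ∃ k, groupElem P g ∈ lowDegree P k := by
  induction g using FreeGroup.induction_on with
  | C1 => exact ⟨1, by simpa using one_mem_lowDegree P one_pos⟩
  | of i =>
    refine ⟨2, ?_⟩
    rw [groupElem_of]
    exact Submodule.add_mem _ (one_mem_lowDegree P two_pos) (U_mem_lowDegree P i one_lt_two)
  | inv_of i _ =>
    refine ⟨3, ?_⟩
    rw [groupElem_of_inv (hP i)]
    exact Submodule.add_mem _ (Submodule.sub_mem _ (one_mem_lowDegree P three_pos)
      (U_mem_lowDegree P i (by norm_num))) (U_sq_mem_lowDegree P i (by norm_num))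
  | mul x y hx hy =>
    obtain ⟨j, hj⟩ := hx
    obtain ⟨k, hk⟩ := hy
    exact ⟨_, by rw [map_mul]; exact mul_mem_lowDegree hj hk⟩

theorem span_range_letterProd (hP : ∀ i, FreeGroup.of i ∈ P) :
    Submodule.span Coeff (Set.range (letterProd P)) = ⊤ := by
  rw [eq_top_iff, ← span_range_groupElem, Submodule.span_le]
  rintro _ ⟨g, rfl⟩
  obtain ⟨k, hk⟩ := exists_groupElem_mem_lowDegree hP g
  exact Submodule.span_mono (Set.image_subset_range _ _) hk

theorem augmentationIdeal_le_span_letterProd (hP : ∀ i, FreeGroup.of i ∈ P) :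
    augmentationIdeal P ≤ Submodule.span Coeff (letterProd P '' {l | l ≠ []}) := by
  refine (augmentationIdeal_le_span_U_mul_top P).trans ?_
  rw [← span_range_letterProd hP, Submodule.span_mul_span, Submodule.span_le]
  rintro _ ⟨_, ⟨i, rfl⟩, _, ⟨l, rfl⟩, rfl⟩
  exact Submodule.subset_span ⟨i :: l, List.cons_ne_nil _ _, letterProd_cons P i l⟩

/-- The degree of a formal monomial. -/
def degree (ν : List (Fin d × Bool)) : ℕ := (ν.map fun l => if l.2 then 1 else 2).sum

theorem degree_cons (l : Fin d × Bool) (ν : List (Fin d × Bool)) :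
    degree (l :: ν) = (if l.2 then 1 else 2) + degree ν := by
  simp [degree]

theorem monomialValue_cons (P : Set (F d)) (l : Fin d × Bool) (ν : List (Fin d × Bool)) :
    monomialValue P (l :: ν) = U P l.1 ^ (if l.2 then 1 else 2) * monomialValue P ν := by
  simp [monomialValue]

theorem wordOf_cons (l : Fin d × Bool) (ν : List (Fin d × Bool)) :
    wordOf (l :: ν) = (if l.2 then FreeGroup.of l.1 else (FreeGroup.of l.1)⁻¹) * wordOf ν := by
  simp [wordOf]

/-- A product of elements `U P i` vanishes or is the value of a monomial of the same degree. -/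
theorem letterProd_eq_zero_or_exists_monomial (hP : ∀ i, FreeGroup.of i ∈ P) (l : List (Fin d)) :
    letterProd P l = 0 ∨ ∃ ν : List (Fin d × Bool), (ν.IsChain fun k l => k.1 ≠ l.1) ∧
      monomialValue P ν = letterProd P l ∧ degree ν = l.length := by
  induction l with
  | nil => exact Or.inr ⟨[], by simp, by simp [monomialValue, letterProd], by simp [degree]⟩
  | cons i l ih =>
    rw [letterProd_cons]
    rcases ih with h | ⟨ν, hν, hv, hd⟩
    · left; rw [h, mul_zero]
    · rw [← hv, List.length_cons, ← hd]
      rcases ν with _ | ⟨⟨j, ε⟩, ν⟩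
      · exact Or.inr ⟨[(i, true)], by simp, by simp [monomialValue], by simp [degree]⟩
      -- A new letter equal to the first index merges with it: U · U² vanishes, and U · U becomes
      -- the single letter U².
      · by_cases hij : i = j
        · subst hij
          cases ε
          · left
            simp [monomialValue_cons, ← mul_assoc, ← pow_succ', U_pow_three (hP i)]
          · refine Or.inr ⟨(i, false) :: ν, ?_, ?_, ?_⟩
            · rw [List.isChain_cons] at hν ⊢
              exact hν
            · simp [monomialValue_cons, ← mul_assoc, sq]
            · simp [degree_cons]; ring
        · refine Or.inr ⟨(i, true) :: (j, ε) :: ν, ?_, ?_, ?_⟩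
          · rw [List.isChain_cons_cons]
            exact ⟨hij, hν⟩
          · rw [monomialValue_cons]; simp
          · rw [degree_cons]; simp [add_comm]

/-- The word of a monomial equals the value of the monomial up to terms of lower degree. -/
theorem groupElem_wordOf_sub_mem (hP : ∀ i, FreeGroup.of i ∈ P) (ν : List (Fin d × Bool)) :
    monomialValue P ν ∈ lowDegree P (degree ν + 1) ∧
      groupElem P (wordOf ν) - monomialValue P ν ∈ lowDegree P (degree ν) := by
  induction ν with
  | nil =>
    constructor
    · simpa [monomialValue, degree] using one_mem_lowDegree P one_pos
    · simp [monomialValue, wordOf]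
  | cons l ν ih =>
    obtain ⟨ih1, ih2⟩ := ih
    obtain ⟨i, ε⟩ := l
    -- Here v is the first power of U, e its exponent, and x the matching group letter with leading
    -- term v.
    have key : ∀ (e : ℕ) (x v : A P), v ∈ lowDegree P (e + 1) → x - v ∈ lowDegree P e →
        v * monomialValue P ν ∈ lowDegree P (e + degree ν + 1) ∧
        x * groupElem P (wordOf ν) - v * monomialValue P ν ∈ lowDegree P (e + degree ν) := by
      intro e x v hv hx
      have hw : groupElem P (wordOf ν) ∈ lowDegree P (degree ν + 1) := by
        simpa using Submodule.add_mem _ (lowDegree_mono P (Nat.le_succ _) ih2) ih1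
      refine ⟨lowDegree_mono P (by omega) (mul_mem_lowDegree hv ih1), ?_⟩
      have : x * groupElem P (wordOf ν) - v * monomialValue P ν =
          (x - v) * groupElem P (wordOf ν)
            + v * (groupElem P (wordOf ν) - monomialValue P ν) := by noncomm_ring
      rw [this]
      exact Submodule.add_mem _ (lowDegree_mono P (by omega) (mul_mem_lowDegree hx hw))
        (lowDegree_mono P (by omega) (mul_mem_lowDegree hv ih2))
    rw [degree_cons, monomialValue_cons, wordOf_cons, map_mul]
    refine key _ _ _ ?_ ?_
    · cases ε
      · exact U_sq_mem_lowDegree P i (by simp)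
      · simpa using U_mem_lowDegree P i one_lt_two
    · cases ε
      -- This is why U² is matched with the inverse letter: y⁻¹ = 1 - U + U² has leading term U².
      · have : groupElem P (FreeGroup.of i)⁻¹ - U P i ^ 2 = 1 - U P i := by
          rw [groupElem_of_inv (hP i)]; noncomm_ring
        simpa [this] using Submodule.sub_mem _ (one_mem_lowDegree P two_pos)
          (U_mem_lowDegree P i one_lt_two)
      · simpa [groupElem_of] using one_mem_lowDegree P one_pos

/-- All reduced monomials with nonzero value. -/
def nonzeroMonomials (P : Set (F d)) : Set (List (Fin d × Bool)) :=
  {ν | ν ≠ [] ∧ (ν.IsChain fun k l => k.1 ≠ l.1) ∧ monomialValue P ν ≠ 0}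

theorem letterProd_eq_zero_or_mem (hP : ∀ i, FreeGroup.of i ∈ P) {l : List (Fin d)} (hl : l ≠ []) :
    letterProd P l = 0 ∨ ∃ ν ∈ nonzeroMonomials P,
      monomialValue P ν = letterProd P l ∧ degree ν = l.length := by
  rcases letterProd_eq_zero_or_exists_monomial hP l with h | ⟨ν, hν, hv, hd⟩
  · exact Or.inl h
  · by_cases h0 : letterProd P l = 0
    · exact Or.inl h0
    · refine Or.inr ⟨ν, ⟨?_, hν, hv ▸ h0⟩, hv, hd⟩
      rintro rfl
      exact hl (List.length_eq_zero_iff.mp hd.symm)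

theorem monomialValue_mem_pow (P : Set (F d)) (ν : List (Fin d × Bool)) :
    monomialValue P ν ∈ augmentationIdeal P ^ ν.length := by
  induction ν with
  | nil => simpa [monomialValue] using (Submodule.one_le (P := (1 : Submodule Coeff (A P)))).mp le_rfl
  | cons l ν ih =>
    rw [monomialValue_cons, List.length_cons]
    refine (pow_succ' (augmentationIdeal P) ν.length).ge (Submodule.mul_mem_mul ?_ ih)
    obtain ⟨i, ε⟩ := l
    cases ε
    · simpa [sq] using
        augmentationIdeal_mul_self_le P (Submodule.mul_mem_mul (U_mem P i) (U_mem P i))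
    · simpa using U_mem P i

theorem pow_le_augmentationIdeal (P : Set (F d)) {n : ℕ} (hn : n ≠ 0) :
    augmentationIdeal P ^ n ≤ augmentationIdeal P := by
  obtain ⟨n, rfl⟩ := Nat.exists_eq_succ_of_ne_zero hn
  exact (pow_succ (augmentationIdeal P) n).le.trans
    ((mul_le_mul' le_top le_rfl).trans (top_mul_augmentationIdeal_le P))

/-- A monomial with s letters lies in the s-th power of the augmentation ideal, so nilpotency bounds
the length of the nonzero ones. -/
theorem isGeneratingMonomials_nonzeroMonomials (hP : ∀ i, FreeGroup.of i ∈ P)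
    (hnil : IsNilpotent (augmentationIdeal P)) :
    IsGeneratingMonomials P (nonzeroMonomials P) where
  finite := by
    obtain ⟨N, hN⟩ := hnil
    refine (List.finite_length_lt (Fin d × Bool) N).subset fun ν hν => ?_
    by_contra hlen
    refine hν.2.2 ?_
    have h := monomialValue_mem_pow P ν
    have hz : augmentationIdeal P ^ ν.length = 0 :=
      pow_eq_zero_of_le (a := augmentationIdeal P) (not_lt.mp hlen) hN
    rw [hz] at h
    exact (Submodule.mem_bot Coeff).mp h
  ne_nil _ hν := hν.1
  isChain _ hν := hν.2.1
  ne_zero _ hν := hν.2.2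
  span_eq := by
    apply le_antisymm
    · rw [Submodule.span_le]
      rintro _ ⟨ν, hν, rfl⟩
      exact pow_le_augmentationIdeal P (fun h => hν.1 (List.length_eq_zero_iff.mp h))
        (monomialValue_mem_pow P ν)
    · refine (augmentationIdeal_le_span_letterProd hP).trans ?_
      rw [Submodule.span_le]
      rintro _ ⟨l, hl, rfl⟩
      rcases letterProd_eq_zero_or_mem hP hl with h | ⟨ν, hν, hv, -⟩
      · rw [h]; exact Submodule.zero_mem _
      · exact Submodule.subset_span ⟨ν, hν, hv⟩

theorem finite_A (hP : ∀ i, FreeGroup.of i ∈ P) (hnil : IsNilpotent (augmentationIdeal P)) :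
    Module.Finite Coeff (A P) := by
  have hW := isGeneratingMonomials_nonzeroMonomials hP hnil
  refine ⟨Submodule.fg_def.mpr
    ⟨insert 1 (monomialValue P '' nonzeroMonomials P), (hW.finite.image _).insert _, ?_⟩⟩
  rw [eq_top_iff, ← span_range_groupElem, Submodule.span_le]
  rintro _ ⟨g, rfl⟩
  have h := groupElem_sub_one_mem P g
  rw [← hW.span_eq] at h
  simpa using Submodule.add_mem _ (Submodule.span_mono (Set.subset_insert _ _) h)
    (Submodule.subset_span (Set.mem_insert (1 : A P) _))

/-- If `Q` contains the words of all nonzero monomials, then the elements `h - 1`, `h ∈ Q`, span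
the augmentation ideal. -/
theorem augmentationIdeal_eq_span_of_wordOf_mem (hP : ∀ i, FreeGroup.of i ∈ P) {Q : Set (F d)}
    (hQ : wordOf '' nonzeroMonomials P ⊆ Q) :
    augmentationIdeal P = Submodule.span Coeff ((fun h => groupElem P h - 1) '' Q) := by
  set V := Submodule.span Coeff ((fun h => groupElem P h - 1) '' Q) with hV
  have hVJ : V ≤ augmentationIdeal P := by
    rw [hV, Submodule.span_le]
    rintro _ ⟨h, -, rfl⟩
    exact groupElem_sub_one_mem P h
  have h1 : (1 : A P) ∈ 1 ⊔ V := Submodule.mem_sup_left (Submodule.one_le.mp le_rfl)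
  -- Induction on degree: modulo lower terms a nonzero monomial is its word, which lies in 1 + V.
  have low : ∀ k, lowDegree P k ≤ 1 ⊔ V := fun k => by
    induction k with
    | zero => simp [lowDegree]
    | succ k ih =>
      rw [lowDegree, Submodule.span_le]
      rintro _ ⟨l, hl, rfl⟩
      rcases eq_or_ne l [] with rfl | hne
      · simpa [letterProd] using h1
      rcases letterProd_eq_zero_or_mem hP hne with h | ⟨ν, hν, hv, hd⟩
      · rw [h]; exact Submodule.zero_mem _
      · have hlow : groupElem P (wordOf ν) - letterProd P l ∈ 1 ⊔ V := by
          rw [← hv]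
          refine ih (lowDegree_mono P ?_ (groupElem_wordOf_sub_mem hP ν).2)
          rw [hd]; exact Nat.lt_succ_iff.mp hl
        have hmem : groupElem P (wordOf ν) ∈ 1 ⊔ V := by
          have : groupElem P (wordOf ν) - 1 ∈ 1 ⊔ V :=
            Submodule.mem_sup_right (Submodule.subset_span ⟨_, hQ ⟨ν, hν, rfl⟩, rfl⟩)
          simpa using Submodule.add_mem _ this h1
        simpa using Submodule.sub_mem _ hmem hlow
  -- The augmentation on the quotient kills V and the given element, and so forces the scalar part
  -- to be zero.
  set aug : A P →ₐ[Coeff] Coeff := liftA 1 (by simp) with haug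
  have aug_zero : ∀ z ∈ augmentationIdeal P, aug z = 0 := by
    have : augmentationIdeal P ≤ LinearMap.ker aug.toLinearMap := by
      rw [augmentationIdeal_eq_span, Submodule.span_le]
      rintro _ ⟨g, rfl⟩
      simp [haug, liftA_groupElem]
    exact fun z hz => this hz
  refine le_antisymm (fun z hz => ?_) hVJ
  have hz' : z ∈ 1 ⊔ V := by
    have hle : ⊤ ≤ 1 ⊔ V := by
      rw [← span_range_groupElem, Submodule.span_le]
      rintro _ ⟨g, rfl⟩
      obtain ⟨k, hk⟩ := exists_groupElem_mem_lowDegree hP g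
      exact low k hk
    exact hle trivial
  obtain ⟨c, hc, v, hv, rfl⟩ := Submodule.mem_sup.mp hz'
  obtain ⟨r, rfl⟩ := Submodule.mem_one.mp hc
  have h0 := aug_zero _ hz
  rw [map_add, aug_zero v (hVJ hv), add_zero, AlgHom.commutes] at h0
  have hr : r = 0 := h0
  rwa [hr, map_zero, zero_add]

/-! ### The inductive construction -/

theorem subset_segmentClosure (S : Set (F d)) : S ⊆ segmentClosure S :=
  Set.subset_union_left

theorem finite_segmentClosure {S : Set (F d)} (hS : S.Finite) : (segmentClosure S).Finite := by
  refine hS.union ((hS.biUnion fun h _ => ?_ :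
    (⋃ h ∈ S, FreeGroup.mk '' {L : List (Fin d × Bool) | L <+: h.toWord}).Finite).subset ?_)
  · refine Set.Finite.image _ ((List.finite_toSet h.toWord.inits).subset fun L hL => ?_)
    exact (List.mem_inits _ _).mpr hL
  · rintro g ⟨h, hh, L, -, hL, rfl⟩
    exact Set.mem_biUnion hh ⟨L, hL, rfl⟩

theorem finite_nextSet {Q : Set (F d)} (hQ : Q.Finite) : (nextSet Q).Finite := by
  have h := hQ.image (FreeGroup.map (Fin.castSucc (n := d)))
  exact (((((h.union (Set.finite_singleton _)).union (h.image _)).union (h.image _)).union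
    (h.image _)).union (h.image _))

theorem mem_nextSet_of_mem {Q : Set (F d)} {h : F d} (hh : h ∈ Q) :
    FreeGroup.map Fin.castSucc h ∈ nextSet Q ∧
      FreeGroup.map Fin.castSucc h * FreeGroup.of (Fin.last d) ∈ nextSet Q ∧
      (FreeGroup.map Fin.castSucc h)⁻¹ * FreeGroup.of (Fin.last d) ∈ nextSet Q ∧
      FreeGroup.map Fin.castSucc h * FreeGroup.of (Fin.last d) ^ 2 ∈ nextSet Q := by
  have m : FreeGroup.map Fin.castSucc h ∈ FreeGroup.map (Fin.castSucc (n := d)) '' Q := ⟨h, hh, rfl⟩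
  refine ⟨?_, ?_, ?_, ?_⟩
  · exact Or.inl (Or.inl (Or.inl (Or.inl (Or.inl m))))
  · exact Or.inl (Or.inl (Or.inl (Or.inr ⟨_, m, rfl⟩)))
  · exact Or.inl (Or.inl (Or.inr ⟨_, m, rfl⟩))
  · exact Or.inl (Or.inr ⟨_, m, rfl⟩)

theorem of_last_mem_nextSet (Q : Set (F d)) : FreeGroup.of (Fin.last d) ∈ nextSet Q :=
  Or.inl (Or.inl (Or.inl (Or.inl (Or.inr rfl))))

/-- The set `P` enlarged by the words of all nonzero monomials and by initial segments. -/
def extendedSet (P : Set (F d)) : Set (F d) :=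
  segmentClosure (P ∪ wordOf '' nonzeroMonomials P)

theorem subset_extendedSet (P : Set (F d)) : P ⊆ extendedSet P :=
  Set.subset_union_left.trans (subset_segmentClosure _)

theorem wordOf_subset_extendedSet (P : Set (F d)) :
    wordOf '' nonzeroMonomials P ⊆ extendedSet P :=
  Set.subset_union_right.trans (subset_segmentClosure _)

/-- The properties of the sets `P d` that are preserved by the inductive construction. -/
structure IsAdmissible (P : Set (F d)) : Prop where
  finite : P.Finite
  of_mem : ∀ i, FreeGroup.of i ∈ P
  isNilpotent : IsNilpotent (augmentationIdeal P)

theorem IsAdmissible.next {P : Set (F d)} (h : IsAdmissible P) :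
    IsAdmissible (nextSet (extendedSet P)) where
  finite := finite_nextSet <| finite_segmentClosure <| h.finite.union <|
    (isGeneratingMonomials_nonzeroMonomials h.of_mem h.isNilpotent).finite.image _
  of_mem i := by
    induction i using Fin.lastCases with
    | last => exact of_last_mem_nextSet _
    | cast i => simpa using (mem_nextSet_of_mem (subset_extendedSet P (h.of_mem i))).1
  isNilpotent := by
    have hsup := augmentationIdeal_eq_span_of_wordOf_mem h.of_mem (wordOf_subset_extendedSet P)
    refine isNilpotent_augmentationIdeal_succ (H := extendedSet P) ?_ h.isNilpotent ?_
      (of_last_mem_nextSet _) fun g hg => mem_nextSet_of_mem hg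
    · rintro _ ⟨g, hg, rfl⟩
      exact (mem_nextSet_of_mem (subset_extendedSet P hg)).1
    -- The elements h - 1 already span, so the inverses add nothing.
    · rw [Submodule.span_union, ← hsup]
      refine (sup_eq_left.mpr ?_).symm
      rw [Submodule.span_le]
      rintro _ ⟨g, -, rfl⟩
      exact groupElem_sub_one_mem P _

/-- Rank one is the general step applied to the trivial group, whose augmentation ideal is zero,
with no elements h. -/
theorem isAdmissible_singleton : IsAdmissible ({FreeGroup.of 0} : Set (F 1)) where
  finite := Set.finite_singleton _
  of_mem i := by rw [Subsingleton.elim i 0]; rfl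
  isNilpotent := by
    have h0 : augmentationIdeal (∅ : Set (F 0)) = 0 := by
      rw [augmentationIdeal_eq_span, Submodule.zero_eq_bot, Submodule.span_eq_bot]
      rintro _ ⟨g, rfl⟩
      change groupElem ∅ g - 1 = 0
      rw [Subsingleton.elim g 1, map_one, sub_self]
    refine isNilpotent_augmentationIdeal_succ (P := (∅ : Set (F 0))) (H := ∅) (by simp)
      ⟨1, (pow_one _).trans h0⟩ ?_ rfl (by simp)
    rw [h0]; simp

/-- Rank two is the general step with y₁ as the only h. The augmentation ideal in rank one is
spanned by U and U², and U² = (y₁⁻¹ - 1) + (y₁ - 1); here the inverses are needed. -/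
theorem isAdmissible_P₂ : IsAdmissible P₂ where
  finite := by
    rw [P₂]
    exact Set.toFinite _
  of_mem i := by
    fin_cases i
    · exact Or.inl rfl
    · exact Or.inr (Or.inl rfl)
  isNilpotent := by
    have h1 := isAdmissible_singleton
    have hmap : FreeGroup.map (Fin.castSucc (n := 1)) (FreeGroup.of 0) = FreeGroup.of 0 := by simp
    have hlast : FreeGroup.of (Fin.last 1) = (FreeGroup.of 1 : F 2) := rfl
    refine isNilpotent_augmentationIdeal_succ (P := {FreeGroup.of 0}) (H := {FreeGroup.of 0})
      ?_ h1.isNilpotent ?_ ?_ ?_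
    · rintro _ ⟨_, rfl, rfl⟩
      rw [hmap]
      exact Or.inl rfl
    · apply le_antisymm
      · refine (augmentationIdeal_le_span_letterProd h1.of_mem).trans ?_
        rw [Submodule.span_le]
        rintro _ ⟨l, hl, rfl⟩
        have hU3 := U_pow_three (h1.of_mem 0)
        have m1 : U {FreeGroup.of 0} 0 ∈ Submodule.span Coeff
            ((fun h => groupElem {FreeGroup.of 0} h - 1) '' {(FreeGroup.of 0 : F 1)} ∪
              (fun h => groupElem {FreeGroup.of 0} h⁻¹ - 1) '' {(FreeGroup.of 0 : F 1)}) :=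
          Submodule.subset_span (Or.inl ⟨_, rfl, (U_eq _ _).symm⟩)
        have hl' : letterProd {FreeGroup.of 0} l = U {FreeGroup.of 0} (0 : Fin 1) ^ l.length := by
          rw [letterProd, List.prod_eq_pow_card _ (U {FreeGroup.of 0} 0), List.length_map]
          intro x hx
          obtain ⟨i, -, rfl⟩ := List.mem_map.mp hx
          rw [Subsingleton.elim i 0]
        rw [hl']
        have hpos := List.length_pos_iff.mpr hl
        obtain h | h | h : l.length = 1 ∨ l.length = 2 ∨ 3 ≤ l.length := by omega
        · rw [h, pow_one]; exact m1
        · have m2 : groupElem {FreeGroup.of 0} (FreeGroup.of (0 : Fin 1))⁻¹ - 1 ∈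
              Submodule.span Coeff
              ((fun h => groupElem {FreeGroup.of 0} h - 1) '' {(FreeGroup.of 0 : F 1)} ∪
                (fun h => groupElem {FreeGroup.of 0} h⁻¹ - 1) '' {(FreeGroup.of 0 : F 1)}) :=
            Submodule.subset_span (Or.inr ⟨_, rfl, rfl⟩)
          have e := Submodule.add_mem _ m2 m1
          rw [groupElem_of_inv (h1.of_mem 0)] at e
          have e' : 1 - U {FreeGroup.of 0} (0 : Fin 1) + U {FreeGroup.of 0} 0 ^ 2 - 1
              + U {FreeGroup.of 0} 0 = U {FreeGroup.of 0} 0 ^ 2 := by noncomm_ring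
          rw [h, ← e']
          exact e
        · rw [← Nat.add_sub_cancel' h, pow_add, hU3, zero_mul]
          exact Submodule.zero_mem _
      · rw [Submodule.span_le]
        rintro _ (⟨g, -, rfl⟩ | ⟨g, -, rfl⟩) <;> exact groupElem_sub_one_mem _ _
    · rw [hlast]
      exact Or.inr (Or.inl rfl)
    · rintro _ rfl
      rw [hmap, hlast]
      simp [P₂]

/-- The sets `P d`, built inductively from `P₂`. -/
def tower : ∀ d : ℕ, Set (F d)
  -- A filler value: the construction starts at rank one.
  | 0 => ∅
  | 1 => {FreeGroup.of 0}
  | 2 => P₂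
  | d + 3 => nextSet (extendedSet (tower (d + 2)))

theorem tower_succ {d : ℕ} (hd : 2 ≤ d) : tower (d + 1) = nextSet (extendedSet (tower d)) := by
  obtain ⟨d, rfl⟩ := Nat.exists_eq_add_of_le' hd
  rw [tower]

theorem isAdmissible_tower {d : ℕ} (hd : 1 ≤ d) : IsAdmissible (tower d) := by
  rcases hd.eq_or_lt with rfl | h2
  · rw [tower]; exact isAdmissible_singleton
  · clear hd
    induction d, h2 using Nat.le_induction with
    | base => rw [tower]; exact isAdmissible_P₂
    | succ d h2 ih => rw [tower_succ h2]; exact ih.next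

theorem P₂_subset_tower {d : ℕ} (hd : 2 ≤ d) : FreeGroup.map (Fin.castLE hd) '' P₂ ⊆ tower d := by
  induction d, hd using Nat.le_induction with
  | base =>
    rw [tower]
    rintro _ ⟨g, hg, rfl⟩
    have : FreeGroup.map (Fin.castLE (le_refl 2)) g = g := FreeGroup.map.id' g
    rwa [this]
  | succ d hd ih =>
    rw [tower_succ hd]
    rintro _ ⟨g, hg, rfl⟩
    have hg' := (mem_nextSet_of_mem (subset_extendedSet _ (ih ⟨g, hg, rfl⟩))).1
    rwa [FreeGroup.map.comp] at hg'

end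

end CubicUnipotent

theorem theorem4 :
    ∃ (P : ∀ d : ℕ, Set (CubicUnipotent.F d)) (W : ∀ d : ℕ, Set (List (Fin d × Bool))),
      -- the inductive construction of the sets `P d`, starting from `y₁` and the set `P₂`
      P 1 = {FreeGroup.of 0} ∧
      P 2 = CubicUnipotent.P₂ ∧
      (∀ d : ℕ, 2 ≤ d →
        CubicUnipotent.IsGeneratingMonomials (P d) (W d) ∧
        P (d + 1) = CubicUnipotent.nextSet
          (CubicUnipotent.segmentClosure (P d ∪ CubicUnipotent.wordOf '' W d))) ∧
      -- every `P d` extends `P₂`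
      (∀ (d : ℕ) (hd : 2 ≤ d),
        FreeGroup.map (Fin.castLE hd) '' CubicUnipotent.P₂ ⊆ P d) ∧
      -- finiteness of `P d`, finite rank of the quotient ring, nilpotency of its augmentation ideal
      (∀ d : ℕ, 1 ≤ d →
        (P d).Finite ∧
        Module.Finite CubicUnipotent.Coeff (CubicUnipotent.A (P d)) ∧
        IsNilpotent (CubicUnipotent.augmentationIdeal (P d))) := by
  refine ⟨CubicUnipotent.tower, fun d => CubicUnipotent.nonzeroMonomials (CubicUnipotent.tower d),
    by rw [CubicUnipotent.tower], by rw [CubicUnipotent.tower], fun d hd => ?_,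
    fun d hd => CubicUnipotent.P₂_subset_tower hd, fun d hd => ?_⟩
  · have h := CubicUnipotent.isAdmissible_tower (one_le_two.trans hd)
    exact ⟨CubicUnipotent.isGeneratingMonomials_nonzeroMonomials h.of_mem h.isNilpotent,
      CubicUnipotent.tower_succ hd⟩
  · have h := CubicUnipotent.isAdmissible_tower hd
    exact ⟨h.finite, CubicUnipotent.finite_A h.of_mem h.isNilpotent, h.isNilpotent⟩
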